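/- \textbf{Setting.} A \emph{pattern matrix} has entries in $\{0,\ast,?\}$. Its \emph{pattern class} $\mathcal P(\mathcal M)$ is the set of real matrices $M$ of the same size with $M_{ij}=0$ if $\mathcal M_{ij}=0$ and $M_{ij}\neq 0$ if $\mathcal M_{ij}=\ast$ (and $M_{ij}$ arbitrary if $\mathcal M_{ij}=\,?$). $\mathcal M$ has \emph{full row rank} if every $M\in\mathcal P(\mathcal M)$ has full row rank. Symbols are added and multiplied commutatively by $0+a=a$, $\ast+\ast=\ast+?=?+?=?$, $0\cdot a=0$, $\ast\cdot a=a$, $?\cdot?=?$, and pattern matrices accordingly. For a square pattern matrix $\mathcal X$, $\bar{\mathcal X}$ is $\mathcal X$ with each diagonal entry $0$ replaced by $\ast$ and each diagonal entry $\ast$ or $?$ replaced by $?$. A pattern row $\mathcal M$ is \emph{independent} of a pattern matrix $\mathcal N$ if for all $M\in\mathcal P(\mathcal M)$, $N\in\mathcal P(\mathcal N)$, $z_1\in\mathbb R$ and real vectors $z_2$, $z_1M+z_2^\top N=0$ implies $z_1=0$. For $k=1,\dots,N$ let $(\mathcal A_k,\mathcal B_k,\mathcal C_k)$ be a node system: $\mathcal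 A_k\in\{0,\ast,?\}^{n_k\times n_k}$, and the column $\mathcal B_k\in\{0,\ast,?\}^{n_k\times 1}$ and the row $\mathcal C_k\in\{0,\ast,?\}^{1\times n_k}$ each have exactly one entry $\ast$ and all other entries $0$. Let $\mathcal W\in\{0,\ast,?\}^{N\times N}$, $\mathcal H\in\{0,\ast,?\}^{N\times m}$, $\mathcal A=\mathrm{bdiag}(\mathcal A_1,\dots,\mathcal A_N)$, and similarly $\mathcal B,\mathcal C$. The structured network $(\mathcal A,\mathcal B,\mathcal C,\mathcal W,\mathcal H)$ is \emph{strongly structurally controllable} if $\dot x=(A+BWC)x+BHu$ is controllable for all $A\in\mathcal P(\mathcal A)$, $B\in\mathcal P(\mathcal B)$, $C\in\mathcal P(\mathcal C)$, $W\in\mathcal P(\mathcal W)$, $H\in\mathcal P(\mathcal H)$. Assume that $[\mathcal A_k\ \ \mathcal B_k]$ and $[\bar{\mathcal A}_k\ \ \mathcal B_k]$ have full row rank for every $k$. \textbf{Standard node systems.} For a node system, let $\mathcal A_{k,1}$ be the row of $\mathcal A_k$ at the position of the $\ast$ in $\mathcal B_k$, and $\mathcal A_{k,2}$ the matrix of the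 remaining rows. Consider the properties (S1) $\mathcal A_{k,1}$ is independent of $\mathrm{col}(\mathcal A_{k,2},\mathcal C_k)$; (S2) $\mathcal A_{k,1}$ is independent of $\mathcal A_{k,2}$; (S3) $\mathcal C_k$ is independent of $\mathcal A_k$; (S4) $\mathcal C_k$ is independent of $\mathcal A_{k,2}$; and the conditions (C1) S1; (C2) S3; (C3) S2 and S4; (C4) S2, not S1, not S4; (C5) S4, not S2, not S3; (C6) neither S2 nor S4. The \emph{standard node system corresponding to} a node system satisfying (C$i$) is $(\hat{\mathcal A}_{(Ci)},\hat{\mathcal B}_{(Ci)},\hat{\mathcal C}_{(Ci)})$ with $$\hat{\mathcal A}_{(C1)}=\begin{bmatrix}0&\ast\\ \ast&0\end{bmatrix},\quad \hat{\mathcal A}_{(C2)}=0,\quad \hat{\mathcal A}_{(C3)}=\ast,\quad \hat{\mathcal A}_{(C4)}=\begin{bmatrix}0&\ast\\ \ast&?\end{bmatrix},\quad \hat{\mathcal A}_{(C5)}=\,?,\quad \hat{\mathcal A}_{(C6)}=\begin{bmatrix}0&0\\ \ast&0\end{bmatrix},$$ and $\hat{\mathcal B}_{(Ci)}^\top=\hat{\mathcal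 C}_{(Ci)}=[\ast\ \ 0]$ for $i=1,4,6$, and $=\ast$ for $i=2,3,5$. \textbf{Theorem.} For every $k$, each of $(\mathcal A_k,\mathcal B_k,\mathcal C_k)$ and $(\bar{\mathcal A}_k,\mathcal B_k,\mathcal C_k)$ satisfies exactly one of (C1)--(C6), so its corresponding standard node system, of dimension $1$ or $2$, is well defined. Let $(\hat{\mathcal A},\hat{\mathcal B},\hat{\mathcal C})$ and $(\hat{\bar{\mathcal A}},\hat{\bar{\mathcal B}},\hat{\bar{\mathcal C}})$ be the block-diagonal compositions over $k=1,\dots,N$ of the standard node systems corresponding to $(\mathcal A_k,\mathcal B_k,\mathcal C_k)$ and to $(\bar{\mathcal A}_k,\mathcal B_k,\mathcal C_k)$, respectively. Then $(\mathcal A,\mathcal B,\mathcal C,\mathcal W,\mathcal H)$ is strongly structurally controllable if and only if both $$\begin{bmatrix}\hat{\mathcal A}+\hat{\mathcal B}\mathcal W\hat{\mathcal C} & \hat{\mathcal B}\mathcal H\end{bmatrix}\quad\text{and}\quad\begin{bmatrix}\hat{\bar{\mathcal A}}+\hat{\bar{\mathcal B}}\mathcal W\hat{\bar{\mathcal C}}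 & \hat{\bar{\mathcal B}}\mathcal H\end{bmatrix}$$ have full row rank. Each of these two pattern matrices has at most $2N$ rows. -/

import Mathlib

namespace StructuredNetwork

open Matrix

/-- The three symbols of pattern matrices: `zero` (the entry is `0`), `star` (the entry is an
arbitrary nonzero real) and `any` (the symbol `?`: the entry is an arbitrary real). -/
inductive Sym : Type
  | zero
  | star
  | any

namespace Sym

/-- Addition table of the symbols. -/
def add : Sym → Sym → Sym
  | zero, b => b
  | star, zero => star
  | star, star => any
  | star, any => any
  | any, _ => any

/-- Multiplication table of the symbols. -/
def mul : Sym → Sym → Sym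
  | zero, _ => zero
  | star, b => b
  | any, zero => zero
  | any, star => any
  | any, any => any

instance : Zero Sym := ⟨zero⟩

instance : Add Sym := ⟨add⟩

instance : Mul Sym := ⟨mul⟩

/-- The two tables satisfy the laws of a commutative semiring, so that sums, products and
block-diagonal composition of pattern matrices are Mathlib's operations on `Matrix _ _ Sym`. -/
instance : NonUnitalCommSemiring Sym where
  nsmul := nsmulRec
  add_assoc := by rintro (_ | _ | _) (_ | _ | _) (_ | _ | _) <;> rfl
  zero_add := by rintro (_ | _ | _) <;> rfl
  add_zero := by rintro (_ | _ | _) <;> rfl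
  add_comm := by rintro (_ | _ | _) (_ | _ | _) <;> rfl
  left_distrib := by rintro (_ | _ | _) (_ | _ | _) (_ | _ | _) <;> rfl
  right_distrib := by rintro (_ | _ | _) (_ | _ | _) (_ | _ | _) <;> rfl
  zero_mul := by rintro (_ | _ | _) <;> rfl
  mul_zero := by rintro (_ | _ | _) <;> rfl
  mul_assoc := by rintro (_ | _ | _) (_ | _ | _) (_ | _ | _) <;> rfl
  mul_comm := by rintro (_ | _ | _) (_ | _ | _) <;> rfl

/-- `s.Allows x`: the real number `x` is a possible value of an entry with symbol `s`. -/
def Allows : Sym → ℝ → Prop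
  | zero, x => x = 0
  | star, x => x ≠ 0
  | any, _ => True

/-- The modification of a diagonal symbol that defines the barred pattern matrix. -/
def bar : Sym → Sym
  | zero => star
  | star => any
  | any => any

end Sym

/-- The pattern class of a pattern matrix. -/
def patternClass {ι κ : Type*} (M : Matrix ι κ Sym) : Set (Matrix ι κ ℝ) :=
  {X | ∀ i j, (M i j).Allows (X i j)}

/-- A pattern matrix has full row rank if every real matrix in its pattern class does. -/
def HasFullRowRank {ι κ : Type*} (M : Matrix ι κ Sym) : Prop :=
  ∀ X ∈ patternClass M, LinearIndependent ℝ X.row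

/-- The pattern row vector `v` is independent of the pattern matrix `M`. -/
def IsIndependentOf {ρ κ : Type*} [Fintype ρ] (v : κ → Sym) (M : Matrix ρ κ Sym) : Prop :=
  ∀ (x : κ → ℝ) (X : Matrix ρ κ ℝ), (∀ j, (v j).Allows (x j)) → X ∈ patternClass M →
    ∀ (z₁ : ℝ) (z₂ : ρ → ℝ), z₁ • x + z₂ ᵥ* X = 0 → z₁ = 0

/-- The matrix `M̄` obtained from a square pattern matrix by changing its diagonal entries:
`0` becomes `∗`, and `∗` and `?` become `?`. -/
def barMatrix {n : ℕ} (M : Matrix (Fin n) (Fin n) Sym) : Matrix (Fin n) (Fin n) Sym :=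
  Matrix.of fun i j => if i = j then (M i j).bar else M i j

/-- A single-input single-output structured node system `(𝒜ₖ, ℬₖ, 𝒞ₖ)` in which the column `ℬₖ`
and the row `𝒞ₖ` each have exactly one nonzero entry, equal to `∗`; these entries stand at the
positions `inPos` and `outPos`. In particular the dimension `n` is positive. -/
structure NodeSystem where
  /-- The state space dimension. -/
  n : ℕ
  /-- The pattern matrix `𝒜ₖ`. -/
  A : Matrix (Fin n) (Fin n) Sym
  /-- The position of the `∗` in `ℬₖ`. -/
  inPos : Fin n
  /-- The position of the `∗` in `𝒞ₖ`. -/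
  outPos : Fin n

namespace NodeSystem

variable (S : NodeSystem)

/-- The pattern vector `ℬₖ` (a column). -/
def B : Fin S.n → Sym := Pi.single S.inPos Sym.star

/-- The pattern vector `𝒞ₖ` (a row). -/
def C : Fin S.n → Sym := Pi.single S.outPos Sym.star

/-- The node system `(𝒜̄ₖ, ℬₖ, 𝒞ₖ)`. -/
def bar : NodeSystem where
  n := S.n
  A := barMatrix S.A
  inPos := S.inPos
  outPos := S.outPos

/-- The pattern matrix `[𝒜ₖ ℬₖ]`. -/
def AB : Matrix (Fin S.n) (Fin S.n ⊕ Fin 1) Sym :=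
  fromCols S.A (replicateCol (Fin 1) S.B)

/-- The row of `𝒜ₖ` at the position of the `∗` entry of `ℬₖ`. -/
def A₁ : Fin S.n → Sym := S.A.row S.inPos

/-- The matrix `𝒜ₖ` without the row at the position of the `∗` entry of `ℬₖ`. -/
def A₂ : Matrix {i : Fin S.n // i ≠ S.inPos} (Fin S.n) Sym := S.A.submatrix Subtype.val id

/-- Property (S1). -/
def S1 : Prop := IsIndependentOf S.A₁ (fromRows S.A₂ (replicateRow (Fin 1) S.C))

/-- Property (S2). -/
def S2 : Prop := IsIndependentOf S.A₁ S.A₂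

/-- Property (S3). -/
def S3 : Prop := IsIndependentOf S.C S.A

/-- Property (S4). -/
def S4 : Prop := IsIndependentOf S.C S.A₂

end NodeSystem

/-- The labels of the six conditions on a node system. -/
inductive Cond : Type
  | C1
  | C2
  | C3
  | C4
  | C5
  | C6

/-- The node system `S` satisfies the condition with the given label. -/
def NodeSystem.Satisfies (S : NodeSystem) : Cond → Prop
  | .C1 => S.S1
  | .C2 => S.S3
  | .C3 => S.S2 ∧ S.S4
  | .C4 => S.S2 ∧ ¬ S.S1 ∧ ¬ S.S4
  | .C5 => S.S4 ∧ ¬ S.S2 ∧ ¬ S.S3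
  | .C6 => ¬ S.S2 ∧ ¬ S.S4

/-- The six standard node systems; in each of them the first entry of `ℬ` and `𝒞` is the `∗`. -/
def standardNode : Cond → NodeSystem
  | .C1 => ⟨2, !![.zero, .star; .star, .zero], 0, 0⟩
  | .C2 => ⟨1, !![.zero], 0, 0⟩
  | .C3 => ⟨1, !![.star], 0, 0⟩
  | .C4 => ⟨2, !![.zero, .star; .star, .any], 0, 0⟩
  | .C5 => ⟨1, !![.any], 0, 0⟩
  | .C6 => ⟨2, !![.zero, .zero; .star, .zero], 0, 0⟩

/-- `T` is the standard node system corresponding to `S`: the one whose label is the condition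
that `S` satisfies. -/
def IsStandardFor (T S : NodeSystem) : Prop := ∃ c, S.Satisfies c ∧ T = standardNode c

section Network

variable {N : ℕ} (S : Fin N → NodeSystem)

/-- The index type of the stacked state `col(x₁, …, x_N)`. -/
abbrev StateIdx : Type := Σ k : Fin N, Fin (S k).n

/-- `bdiag(𝒜₁, …, 𝒜_N)`. -/
def blkA : Matrix (StateIdx S) (StateIdx S) Sym := blockDiagonal' fun k => (S k).A

/-- `bdiag(ℬ₁, …, ℬ_N)`, the blocks being columns. -/
def blkB : Matrix (StateIdx S) (Fin N) Sym :=
  Matrix.of fun i l => if i.1 = l then (S i.1).B i.2 else 0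

/-- `bdiag(𝒞₁, …, 𝒞_N)`, the blocks being rows. -/
def blkC : Matrix (Fin N) (StateIdx S) Sym :=
  Matrix.of fun l i => if i.1 = l then (S i.1).C i.2 else 0

/-- The pattern matrix `[𝒜 + ℬ𝒲𝒞  ℬℋ]`. -/
def networkPattern {m : ℕ} (W : Matrix (Fin N) (Fin N) Sym) (H : Matrix (Fin N) (Fin m) Sym) :
    Matrix (StateIdx S) (StateIdx S ⊕ Fin m) Sym :=
  fromCols (blkA S + blkB S * W * blkC S) (blkB S * H)

end Network

/-- The linear system `ẋ = A x + B u` is controllable: any state can be steered to any state in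
some finite time by some (continuous) input. -/
def IsControllable {ι μ : Type*} [Fintype ι] [Fintype μ] (A : Matrix ι ι ℝ) (B : Matrix ι μ ℝ) :
    Prop :=
  ∀ x₀ x₁ : ι → ℝ, ∃ T : ℝ, 0 < T ∧ ∃ (u : ℝ → μ → ℝ) (x : ℝ → ι → ℝ),
    ContinuousOn u (Set.Icc 0 T) ∧ x 0 = x₀ ∧ x T = x₁ ∧
    ∀ t ∈ Set.Icc 0 T, HasDerivWithinAt x (A *ᵥ x t + B *ᵥ u t) (Set.Icc 0 T) t

/-- Strong structural controllability of the structured network `(𝒜, ℬ, 𝒞, 𝒲, ℋ)`. -/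
def IsStronglyStructurallyControllable {N m : ℕ} (S : Fin N → NodeSystem)
    (W : Matrix (Fin N) (Fin N) Sym) (H : Matrix (Fin N) (Fin m) Sym) : Prop :=
  ∀ A ∈ patternClass (blkA S), ∀ B ∈ patternClass (blkB S), ∀ C ∈ patternClass (blkC S),
    ∀ W' ∈ patternClass W, ∀ H' ∈ patternClass H, IsControllable (A + B * W' * C) (B * H')

end StructuredNetwork

open StructuredNetwork

/-! With nonzero coefficients, the combinations of values allowed by given symbols are exactly the
values allowed by the sum of the symbols, because `∗ + ∗ = ?`. Hence a row set supports a left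
kernel vector of some member of a pattern class iff no column sum over it is `∗`
(`exists_vecMul_eq_zero_iff`), and full row rank and independence become finite combinatorics.

Controllability of a whole class amounts to two rank conditions (`forall_isControllable_iff`). If a
system `(A, B)` is not controllable, the left kernel of `B` contains a nonzero `A`-invariant
subspace. Either `A` is singular on it, which gives a left kernel vector of `[A B]`, or `A` is
bijective on it; then a generic `w` has the same support as `w A`, so `w (A + D) = 0` for a
nonsingular diagonal `D`. Conversely, a kernel vector of `[X + D, Y]` is a left eigenvector of `X
D⁻¹`, which lies in the same class as `X`. Adding `D` on the pattern level produces the barred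
nodes.

The rank test of a network sees a node only through `Admits`: whether the chosen rows include the
input row, and which symbol the interconnection adds to the output column. Only `Admits True 0`,
`Admits True ∗` and `Admits False ∗` carry information, and (S1)-(S4) are Boolean combinations of
them. Of the eight truth assignments two are impossible: all false, by counting rows and columns
(`admits_of_hasFullRowRank`), and the first and third without the second, by uniting row sets
(`Admits.union`). The other six are (C1)-(C6), and each standard node realises its own assignment,
so substituting it preserves the rank test. -/

namespace StructuredNetwork

open Matrix

/-! ### Symbol arithmetic and the real values it allows. -/

namespace Sym

instance : DecidableEq Sym
  | zero, zero => isTrue rfl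
  | zero, star => isFalse nofun
  | zero, any => isFalse nofun
  | star, zero => isFalse nofun
  | star, star => isTrue rfl
  | star, any => isFalse nofun
  | any, zero => isFalse nofun
  | any, star => isFalse nofun
  | any, any => isTrue rfl

@[simp] theorem allows_zero_iff {x : ℝ} : Allows 0 x ↔ x = 0 := Iff.rfl

theorem allows_zero_right_iff {s : Sym} : s.Allows 0 ↔ s ≠ star := by
  cases s <;> simp [Allows]

theorem exists_allows (s : Sym) : ∃ x, s.Allows x := by
  cases s
  exacts [⟨0, rfl⟩, ⟨1, one_ne_zero⟩, ⟨0, trivial⟩]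

theorem Allows.add {s t : Sym} {x y : ℝ} (hs : s.Allows x) (ht : t.Allows y) :
    (s + t).Allows (x + y) := by
  change (Sym.add s t).Allows (x + y)
  cases s <;> cases t <;> simp_all [Allows, Sym.add]

theorem Allows.mul {s t : Sym} {x y : ℝ} (hs : s.Allows x) (ht : t.Allows y) :
    (s * t).Allows (x * y) := by
  change (Sym.mul s t).Allows (x * y)
  cases s <;> cases t <;> simp_all [Allows, Sym.mul]

theorem Allows.sum {ι : Type*} {I : Finset ι} {s : ι → Sym} {x : ι → ℝ}
    (h : ∀ i ∈ I, (s i).Allows (x i)) : (∑ i ∈ I, s i).Allows (∑ i ∈ I, x i) := by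
  classical
  induction I using Finset.induction_on with
  | empty => simp
  | insert i I hi ih =>
    rw [Finset.sum_insert hi, Finset.sum_insert hi]
    exact (h i (by simp)).add (ih fun k hk => h k (by simp [hk]))

theorem allows_mul_iff {s : Sym} {c x : ℝ} (hc : c ≠ 0) : s.Allows (c * x) ↔ s.Allows x := by
  cases s <;> simp [Allows, hc]

theorem exists_add_of_allows {s t : Sym} {x : ℝ} (h : (s + t).Allows x) :
    ∃ y z, s.Allows y ∧ t.Allows z ∧ y + z = x := by
  change (Sym.add s t).Allows x at h
  rcases s with _ | _ | _
  · exact ⟨0, x, rfl, h, zero_add x⟩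
  · rcases t with _ | _ | _
    · exact ⟨x, 0, h, rfl, add_zero x⟩
    -- The split `1 + (x - 1)` has a forbidden zero summand exactly when `x = 1`.
    · by_cases hx : x = 1
      · exact ⟨-1, 2, by simp [Allows], by simp [Allows], by rw [hx]; norm_num⟩
      · exact ⟨1, x - 1, by simp [Allows], by simpa [Allows, sub_eq_zero] using hx, by ring⟩
    · exact ⟨1, x - 1, by simp [Allows], trivial, by ring⟩
  · obtain ⟨z, hz⟩ := t.exists_allows
    exact ⟨x - z, z, trivial, hz, by ring⟩

/-- Every value allowed by a sum of symbols is a combination, with prescribed nonzero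
coefficients, of values allowed by the summands. -/
theorem exists_sum_mul_of_allows {ι : Type*} {I : Finset ι} {s : ι → Sym} {z : ι → ℝ}
    (hz : ∀ i ∈ I, z i ≠ 0) {x : ℝ} (h : (∑ i ∈ I, s i).Allows x) :
    ∃ a : ι → ℝ, (∀ i, (s i).Allows (a i)) ∧ ∑ i ∈ I, z i * a i = x := by
  classical
  induction I using Finset.induction_on generalizing x with
  | empty =>
    choose a ha using fun i => (s i).exists_allows
    exact ⟨a, ha, by simpa using h.symm⟩
  | insert i I hi ih =>
    rw [Finset.sum_insert hi] at h
    obtain ⟨y, y', hy, hy', rfl⟩ := exists_add_of_allows h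
    obtain ⟨a, ha, has⟩ := ih (fun k hk => hz k (by simp [hk])) hy'
    have hzi : z i ≠ 0 := hz i (by simp)
    refine ⟨Function.update a i ((z i)⁻¹ * y), fun k => ?_, ?_⟩
    · rcases eq_or_ne k i with rfl | hk
      · simpa using (allows_mul_iff (inv_ne_zero hzi)).2 hy
      · simpa [hk] using ha k
    · rw [Finset.sum_insert hi, Function.update_self, mul_inv_cancel_left₀ hzi, ← has]
      congr 1
      refine Finset.sum_congr rfl fun k hk => ?_
      rw [Function.update_of_ne (by rintro rfl; exact hi hk)]

theorem bar_eq_add_star (s : Sym) : s.bar = s + star := by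
  cases s <;> rfl

theorem star_mul (s : Sym) : star * s = s := by
  cases s <;> rfl

theorem mul_star (s : Sym) : s * star = s := by
  cases s <;> rfl

theorem add_eq_star_iff {s t : Sym} :
    s + t = star ↔ s = star ∧ t = 0 ∨ s = 0 ∧ t = star := by
  cases s <;> cases t <;> decide

theorem add_eq_zero_iff {s t : Sym} : s + t = 0 ↔ s = 0 ∧ t = 0 := by
  cases s <;> cases t <;> decide

end Sym

/-! ### Column-sum criteria for full row rank and independence. -/

section PatternClass

variable {ι κ ρ : Type*}

theorem patternClass_nonempty (M : Matrix ι κ Sym) : (patternClass M).Nonempty := by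
  choose X hX using fun i j => (M i j).exists_allows
  exact ⟨X, hX⟩

theorem add_mem_patternClass {M M' : Matrix ι κ Sym} {X X' : Matrix ι κ ℝ}
    (hX : X ∈ patternClass M) (hX' : X' ∈ patternClass M') : X + X' ∈ patternClass (M + M') :=
  fun i j => (hX i j).add (hX' i j)

theorem mul_mem_patternClass [Fintype κ] {M : Matrix ι κ Sym} {M' : Matrix κ ρ Sym}
    {X : Matrix ι κ ℝ} {X' : Matrix κ ρ ℝ} (hX : X ∈ patternClass M)
    (hX' : X' ∈ patternClass M') : X * X' ∈ patternClass (M * M') := fun i j => by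
  rw [mul_apply, mul_apply]
  exact Sym.Allows.sum fun k _ => (hX i k).mul (hX' k j)

theorem exists_add_of_mem_patternClass {M M' : Matrix ι κ Sym} {X : Matrix ι κ ℝ}
    (hX : X ∈ patternClass (M + M')) :
    ∃ Y ∈ patternClass M, ∃ Z ∈ patternClass M', Y + Z = X := by
  choose Y Z hY hZ h using fun i j => Sym.exists_add_of_allows (hX i j)
  exact ⟨Y, hY, Z, hZ, by ext i j; exact h i j⟩

theorem fromCols_mem_patternClass {M : Matrix ι κ Sym} {M' : Matrix ι ρ Sym}
    {X : Matrix ι κ ℝ} {X' : Matrix ι ρ ℝ} (hX : X ∈ patternClass M)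
    (hX' : X' ∈ patternClass M') : fromCols X X' ∈ patternClass (fromCols M M') := by
  rintro i (j | j)
  exacts [hX i j, hX' i j]

variable [Fintype ι]

/-- A vector with support `I` is in the left kernel of some matrix in a pattern class if and only
if no column sum over the rows in `I` is the symbol `∗`. -/
theorem exists_vecMul_eq_zero_iff (M : Matrix ι κ Sym) {z : ι → ℝ} {I : Finset ι}
    (hI : ∀ i, i ∈ I ↔ z i ≠ 0) :
    (∃ X ∈ patternClass M, z ᵥ* X = 0) ↔ ∀ j, ∑ i ∈ I, M i j ≠ .star := by
  have key (X : Matrix ι κ ℝ) (j : κ) : (z ᵥ* X) j = ∑ i ∈ I, z i * X i j :=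
    (Finset.sum_subset (Finset.subset_univ I) fun i _ hi => by
      rw [hI, not_not] at hi; simp [hi]).symm
  constructor
  · rintro ⟨X, hX, h⟩ j
    have h0 : ∑ i ∈ I, z i * X i j = 0 := by rw [← key, h, Pi.zero_apply]
    rw [← Sym.allows_zero_right_iff, ← h0]
    exact Sym.Allows.sum fun i hi => (Sym.allows_mul_iff ((hI i).1 hi)).2 (hX i j)
  · intro h
    choose a ha h0 using fun j => Sym.exists_sum_mul_of_allows (z := z)
      (fun i hi => (hI i).1 hi) (Sym.allows_zero_right_iff.2 (h j))
    refine ⟨of fun i j => a j i, fun i j => ha j i, ?_⟩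
    ext j
    rw [key]
    exact h0 j

theorem linearIndependent_row_iff {X : Matrix ι κ ℝ} :
    LinearIndependent ℝ X.row ↔ ∀ z : ι → ℝ, z ᵥ* X = 0 → z = 0 := by
  rw [Fintype.linearIndependent_iff]
  refine forall_congr' fun z => ?_
  rw [vecMul_eq_sum, funext_iff (f := z)]
  rfl

theorem hasFullRowRank_iff (M : Matrix ι κ Sym) :
    HasFullRowRank M ↔ ∀ I : Finset ι, I.Nonempty → ∃ j, ∑ i ∈ I, M i j = .star := by
  classical
  constructor
  · intro h I hI
    by_contra! hc
    obtain ⟨X, hX, h0⟩ := (exists_vecMul_eq_zero_iff M (z := fun i => if i ∈ I then 1 else 0)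
      (I := I) (by simp)).2 hc
    obtain ⟨i, hi⟩ := hI
    simpa [hi] using congrFun (linearIndependent_row_iff.1 (h X hX) _ h0) i
  · intro h X hX
    rw [linearIndependent_row_iff]
    intro z hz
    by_contra hne
    obtain ⟨i, hi⟩ := Function.ne_iff.1 hne
    obtain ⟨j, hj⟩ := h (Finset.univ.filter fun i => z i ≠ 0) ⟨i, by simpa using hi⟩
    exact (exists_vecMul_eq_zero_iff M (by simp)).1 ⟨X, hX, hz⟩ j hj

/-- Stack `v` on top of `M`: dependence is a left kernel vector whose support contains the extra row
`none`, so only row sets with that row are tested. -/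
theorem isIndependentOf_iff (v : κ → Sym) (M : Matrix ι κ Sym) :
    IsIndependentOf v M ↔ ∀ I : Finset ι, ∃ j, v j + ∑ i ∈ I, M i j = .star := by
  classical
  let M' : Matrix (Option ι) κ Sym := of fun o j => o.elim (v j) fun i => M i j
  have hM' (I : Finset ι) (j : κ) :
      ∑ i ∈ Finset.insertNone I, M' i j = v j + ∑ i ∈ I, M i j := by
    rw [Finset.sum_insertNone]; rfl
  constructor
  · intro h I
    by_contra! hc
    obtain ⟨X, hX, h0⟩ := (exists_vecMul_eq_zero_iff M'
      (z := fun i => if i ∈ Finset.insertNone I then 1 else 0) (I := Finset.insertNone I)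
      (by simp)).2 (by simpa only [hM'] using hc)
    have := h (X none) (of fun i => X (some i)) (fun j => hX none j) (fun i j => hX (some i) j)
      1 (fun i => if some i ∈ Finset.insertNone I then 1 else 0) (by
        ext j
        have := congrFun h0 j
        simp only [vecMul, dotProduct, Fintype.sum_option] at this
        simpa [vecMul, dotProduct] using this)
    exact one_ne_zero this
  · intro h x X hx hX z₁ z₂ h0
    by_contra hz₁
    obtain ⟨j, hj⟩ := h (Finset.univ.filter fun i => z₂ i ≠ 0)
    refine (exists_vecMul_eq_zero_iff M' (z := fun o => o.elim z₁ z₂)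
      (I := Finset.insertNone (Finset.univ.filter fun i => z₂ i ≠ 0)) ?_).1
      ⟨of fun o j => o.elim (x j) fun i => X i j, ?_, ?_⟩ j ?_
    · rintro (_ | i) <;> simp [hz₁]
    · rintro (_ | i) j
      exacts [hx j, hX i j]
    · ext j
      have := congrFun h0 j
      simpa [vecMul, dotProduct, Fintype.sum_option] using this
    · rw [← hj, ← hM']

/-- A pattern matrix with more rows than columns does not have full row rank. -/
theorem not_hasFullRowRank_of_card_lt [Fintype κ] (M : Matrix ι κ Sym)
    (h : Fintype.card κ < Fintype.card ι) : ¬ HasFullRowRank M := by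
  intro hM
  obtain ⟨X, hX⟩ := patternClass_nonempty M
  have := (hM X hX).fintype_card_le_finrank
  rw [Module.finrank_fintype_fun_eq_card] at this
  omega

end PatternClass

/-! ### Row sets containing or avoiding a fixed row, as row sets of the remaining rows. -/

section ColumnSums

variable {n : ℕ} {κ : Type*} (M : Matrix (Fin n) κ Sym) (p : Fin n)

theorem exists_finset_mem_iff (Q : (κ → Sym) → Prop) :
    (∃ I : Finset (Fin n), p ∈ I ∧ Q fun j => ∑ i ∈ I, M i j) ↔
      ∃ I : Finset {i : Fin n // i ≠ p},
        Q fun j => M p j + ∑ i ∈ I, M.submatrix Subtype.val id i j := by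
  constructor
  · rintro ⟨I, hp, hQ⟩
    refine ⟨I.subtype (· ≠ p), ?_⟩
    convert hQ using 2 with j
    rw [← Finset.add_sum_erase I _ hp, ← Finset.filter_ne' I p]
    congr 1
    exact Finset.sum_subtype_eq_sum_filter (fun i => M i j)
  · rintro ⟨I, hQ⟩
    have hp : p ∉ I.map (Function.Embedding.subtype _) := by simp
    refine ⟨insert p (I.map (Function.Embedding.subtype _)), by simp, ?_⟩
    convert hQ using 2 with j
    rw [Finset.sum_insert hp, Finset.sum_map]
    rfl

theorem exists_finset_notMem_iff (Q : (κ → Sym) → Prop) :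
    (∃ I : Finset (Fin n), p ∉ I ∧ Q fun j => ∑ i ∈ I, M i j) ↔
      ∃ I : Finset {i : Fin n // i ≠ p},
        Q fun j => ∑ i ∈ I, M.submatrix Subtype.val id i j := by
  constructor
  · rintro ⟨I, hp, hQ⟩
    refine ⟨I.subtype (· ≠ p), ?_⟩
    convert hQ using 2 with j
    nth_rw 2 [← Finset.erase_eq_of_notMem hp]
    rw [← Finset.filter_ne' I p]
    exact Finset.sum_subtype_eq_sum_filter (fun i => M i j)
  · rintro ⟨I, hQ⟩
    refine ⟨I.map (Function.Embedding.subtype _), by simp, ?_⟩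
    convert hQ using 2 with j
    rw [Finset.sum_map]
    rfl

end ColumnSums

/-! ### Admissible pairs of a node system and the six conditions. -/

namespace NodeSystem

variable (S : NodeSystem)

/-- The pattern row vector whose only nonzero entry is `w`, at the output position. -/
def out (w : Sym) : Fin S.n → Sym := Pi.single S.outPos w

@[simp] theorem out_self (w : Sym) : S.out w S.outPos = w := Pi.single_eq_same _ _

theorem out_of_ne {j : Fin S.n} (h : j ≠ S.outPos) (w : Sym) : S.out w j = 0 :=
  Pi.single_eq_of_ne h _

@[simp] theorem out_zero (j : Fin S.n) : S.out 0 j = 0 := by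
  rw [out, Pi.single_zero, Pi.zero_apply]

theorem C_eq_out : S.C = S.out .star := rfl

/-- Some set of rows of `𝒜ₖ`, containing the input position if and only if `a` holds, has column
sums different from `∗` once the symbol `w` is added at the output position. -/
def Admits (a : Prop) (w : Sym) : Prop :=
  ∃ I : Finset (Fin S.n), (S.inPos ∈ I ↔ a) ∧
    ∀ j, ∑ i ∈ I, S.A i j + S.out w j ≠ Sym.star

theorem admits_true_iff (w : Sym) :
    S.Admits True w ↔ ∃ I : Finset {i : Fin S.n // i ≠ S.inPos},
      ∀ j, S.A₁ j + ∑ i ∈ I, S.A₂ i j + S.out w j ≠ Sym.star := by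
  simp only [Admits, iff_true]
  exact exists_finset_mem_iff S.A S.inPos
    fun f => ∀ j, f j + S.out w j ≠ Sym.star

theorem admits_false_iff (w : Sym) :
    S.Admits False w ↔ ∃ I : Finset {i : Fin S.n // i ≠ S.inPos},
      ∀ j, ∑ i ∈ I, S.A₂ i j + S.out w j ≠ Sym.star := by
  simp only [Admits, iff_false]
  exact exists_finset_notMem_iff S.A S.inPos
    fun f => ∀ j, f j + S.out w j ≠ Sym.star

theorem s2_iff : S.S2 ↔ ¬ S.Admits True 0 := by
  rw [S2, isIndependentOf_iff, admits_true_iff]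
  push Not
  simp

theorem s4_iff : S.S4 ↔ ¬ S.Admits False .star := by
  rw [S4, isIndependentOf_iff, admits_false_iff]
  push Not
  simp only [C_eq_out, add_comm]

theorem s3_iff : S.S3 ↔ ¬ S.Admits True .star ∧ ¬ S.Admits False .star := by
  rw [S3, isIndependentOf_iff, Admits, Admits]
  simp only [iff_true, iff_false]
  push Not
  simp only [C_eq_out, add_comm]
  exact ⟨fun h => ⟨fun I _ => h I, fun I _ => h I⟩, fun h I => by
    by_cases hI : S.inPos ∈ I
    exacts [h.1 I hI, h.2 I hI]⟩

/-- A row set of `col(𝒜₂, 𝒞)` either omits the row `𝒞` or uses it, which adds `0` or `∗` in the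
output column. -/
theorem s1_iff : S.S1 ↔ ¬ S.Admits True 0 ∧ ¬ S.Admits True .star := by
  rw [S1, isIndependentOf_iff, admits_true_iff, admits_true_iff]
  push Not
  constructor
  · intro h
    refine ⟨fun I => ?_, fun I => ?_⟩
    · obtain ⟨j, hj⟩ := h (I.disjSum ∅)
      exact ⟨j, by simpa using! hj⟩
    · obtain ⟨j, hj⟩ := h (I.disjSum Finset.univ)
      refine ⟨j, ?_⟩
      rw [Finset.sum_disjSum] at hj
      simpa [C_eq_out, add_assoc] using! hj
  · rintro ⟨h₀, h₁⟩ I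
    have hR : I.toRight = ∅ ∨ I.toRight = Finset.univ := by
      rcases I.toRight.eq_empty_or_nonempty with h | ⟨x, hx⟩
      · exact .inl h
      · exact .inr (Finset.eq_univ_iff_forall.2 fun y => Subsingleton.elim x y ▸ hx)
    rw [← Finset.toLeft_disjSum_toRight (u := I)]
    simp only [Finset.sum_disjSum]
    rcases hR with hR | hR
    · obtain ⟨j, hj⟩ := h₀ I.toLeft
      exact ⟨j, by rw [hR]; simpa using! hj⟩
    · obtain ⟨j, hj⟩ := h₁ I.toLeft
      refine ⟨j, ?_⟩
      rw [hR]
      simpa [C_eq_out, add_assoc] using! hj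

theorem admits_false_zero : S.Admits False 0 :=
  ⟨∅, by simp, fun j => by simp⟩

/-- Adding `?` removes the constraint on the output column. The sum there avoids `∗` after adding
`∗` if it was `∗` itself, and after adding `0` otherwise. -/
theorem admits_any_iff (a : Prop) : S.Admits a .any ↔ S.Admits a 0 ∨ S.Admits a .star := by
  constructor
  · rintro ⟨I, hI, h⟩
    by_cases h0 : ∑ i ∈ I, S.A i S.outPos = .star
    · refine .inr ⟨I, hI, fun j => ?_⟩
      rcases eq_or_ne j S.outPos with rfl | hj
      · rw [h0, out_self]; decide
      · simpa [S.out_of_ne hj] using h j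
    · refine .inl ⟨I, hI, fun j => ?_⟩
      rcases eq_or_ne j S.outPos with rfl | hj
      · simpa using h0
      · simpa [S.out_of_ne hj] using h j
  · have key (w : Sym) : S.Admits a w → S.Admits a .any := by
      rintro ⟨I, hI, h⟩
      refine ⟨I, hI, fun j => ?_⟩
      rcases eq_or_ne j S.outPos with rfl | hj
      · rw [out_self]
        rcases ∑ i ∈ I, S.A i S.outPos with _ | _ | _ <;> decide
      · simpa [S.out_of_ne hj] using h j
    rintro (h | h)
    exacts [key _ h, key _ h]

/-- The union of two sets of rows without `∗` among their column sums has the same property. -/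
theorem Admits.union {S : NodeSystem} (h₁ : S.Admits True 0) (h₂ : S.Admits False .star) :
    S.Admits True .star := by
  obtain ⟨I, hI, h⟩ := h₁
  obtain ⟨I', hI', h'⟩ := h₂
  -- A sum is `∗` only if one summand is `∗` and all others are `0`. Off the output column that row
  -- lies in `I` or `I'`, whose own sum would then be `∗`. In the output column the added `∗` must
  -- be the only nonzero term, so the rows of `I'` vanish there, against the choice of `I'`.
  refine ⟨I ∪ I', by simp [hI.2], fun j => ?_⟩
  have hu : ∑ i ∈ I ∪ I', S.A i j = ∑ i ∈ I, S.A i j + ∑ i ∈ I' \ I, S.A i j := by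
    rw [← Finset.union_sdiff_self_eq_union, Finset.sum_union Finset.disjoint_sdiff]
  have hu' : ∑ i ∈ I ∪ I', S.A i j = ∑ i ∈ I', S.A i j + ∑ i ∈ I \ I', S.A i j := by
    rw [Finset.union_comm, ← Finset.union_sdiff_self_eq_union,
      Finset.sum_union Finset.disjoint_sdiff]
  have h1 := h j
  have h2 := h' j
  rw [out_zero, add_zero] at h1
  rcases eq_or_ne j S.outPos with rfl | hj
  · rw [out_self] at h2 ⊢
    intro h0
    rcases Sym.add_eq_star_iff.1 h0 with ⟨-, h3⟩ | ⟨h3, -⟩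
    · exact absurd h3 (by decide)
    · rw [hu', Sym.add_eq_zero_iff] at h3
      exact h2 (by rw [h3.1]; rfl)
  · rw [S.out_of_ne hj, add_zero] at h2 ⊢
    intro h0
    rw [hu, Sym.add_eq_star_iff] at h0
    rcases h0 with ⟨h3, -⟩ | ⟨h3, h4⟩
    · exact h1 h3
    · have h5 : ∑ i ∈ I ∪ I', S.A i j = .star := by rw [hu, h3, h4]; rfl
      rw [hu', Sym.add_eq_star_iff] at h5
      rcases h5 with ⟨h6, -⟩ | ⟨h6, -⟩
      · exact h2 h6
      · rw [← Finset.sum_inter_add_sum_sdiff I' I, add_comm] at h6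
        rw [(Sym.add_eq_zero_iff.1 h6).1] at h4
        exact absurd h4 (by decide)

/-- Row sets with the input row already have the sum `∗` in the column `ℬ`; all others have `0`
there and must find their `∗` in `𝒜`. -/
theorem ab_hasFullRowRank_iff : HasFullRowRank S.AB ↔
    ∀ I : Finset (Fin S.n), I.Nonempty → S.inPos ∉ I → ∃ j, ∑ i ∈ I, S.A i j = .star := by
  have hB (I : Finset (Fin S.n)) :
      ∑ i ∈ I, S.AB i (.inr 0) = if S.inPos ∈ I then Sym.star else 0 :=
    Finset.sum_pi_single' S.inPos Sym.star I
  rw [hasFullRowRank_iff]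
  refine forall₂_congr fun I _ => ⟨fun h hp => ?_, fun h => ?_⟩
  · obtain ⟨j | j, hj⟩ := h
    · exact ⟨j, hj⟩
    · rw [Subsingleton.elim j 0, hB, if_neg hp] at hj
      exact absurd hj (by decide)
  · by_cases hp : S.inPos ∈ I
    · exact ⟨.inr 0, by rw [hB, if_pos hp]⟩
    · obtain ⟨j, hj⟩ := h hp
      exact ⟨.inl j, hj⟩

/-- `𝒞` stacked on `𝒜` has `n + 1` rows and `n` columns, so some nonempty row set has no column sum
`∗`. The three alternatives record whether it uses `𝒞` and the input row; using neither would
contradict the rank hypothesis. -/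
theorem admits_of_hasFullRowRank (h : HasFullRowRank S.AB) :
    S.Admits True 0 ∨ S.Admits True .star ∨ S.Admits False .star := by
  have hc : ¬ HasFullRowRank (of fun o : Option (Fin S.n) => o.elim S.C S.A) :=
    not_hasFullRowRank_of_card_lt _ (by simp)
  rw [hasFullRowRank_iff] at hc
  push Not at hc
  obtain ⟨I, hI, hj⟩ := hc
  by_cases hn : none ∈ I
  · have key (j : Fin S.n) : ∑ i ∈ Finset.eraseNone I, S.A i j + S.out .star j ≠ .star := by
      have := hj j
      rw [← Finset.insert_eq_of_mem hn, ← Finset.insertNone_eraseNone, Finset.sum_insertNone,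
        add_comm] at this
      exact this
    by_cases hp : S.inPos ∈ Finset.eraseNone I
    exacts [.inr (.inl ⟨_, iff_of_true hp trivial, key⟩),
      .inr (.inr ⟨_, iff_of_false hp not_false, key⟩)]
  · have hI' : (Finset.eraseNone I).map Function.Embedding.some = I := by
      rw [Finset.map_some_eraseNone, Finset.erase_eq_of_notMem hn]
    have key (j : Fin S.n) : ∑ i ∈ Finset.eraseNone I, S.A i j ≠ .star := by
      have := hj j
      rw [← hI', Finset.sum_map] at this
      exact this
    refine .inl ⟨_, iff_of_true ?_ trivial, fun j => by simpa using key j⟩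
    by_contra hp
    obtain ⟨j, h0⟩ := S.ab_hasFullRowRank_iff.1 h _
      (Finset.map_nonempty.1 (by rwa [hI'])) hp
    exact key j h0

theorem satisfies_iff (c : Cond) : S.Satisfies c ↔ match c with
    | .C1 => ¬ S.Admits True 0 ∧ ¬ S.Admits True .star
    | .C2 => ¬ S.Admits True .star ∧ ¬ S.Admits False .star
    | .C3 => ¬ S.Admits True 0 ∧ ¬ S.Admits False .star
    | .C4 => ¬ S.Admits True 0 ∧ S.Admits True .star ∧ S.Admits False .star
    | .C5 => ¬ S.Admits False .star ∧ S.Admits True 0 ∧ S.Admits True .star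
    | .C6 => S.Admits True 0 ∧ S.Admits False .star := by
  cases c <;> simp only [Satisfies, s1_iff, s2_iff, s3_iff, s4_iff] <;> tauto

theorem existsUnique_satisfies (h : HasFullRowRank S.AB) : ∃! c, S.Satisfies c := by
  have h₁ := S.admits_of_hasFullRowRank h
  have h₂ : S.Admits True 0 → S.Admits False .star → S.Admits True .star := Admits.union
  simp only [ExistsUnique, satisfies_iff]
  by_cases a : S.Admits True 0 <;> by_cases b : S.Admits True .star <;>
    by_cases c : S.Admits False .star <;>
    simp only [a, b, c, or_true, or_false, true_implies] at h₁ h₂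
  · exact ⟨.C6, by simp [a, c], by rintro (_ | _) <;> simp [a, b, c]⟩
  · exact ⟨.C5, by simp [a, b, c], by rintro (_ | _) <;> simp [a, b, c]⟩
  · exact ⟨.C2, by simp [b, c], by rintro (_ | _) <;> simp [a, b, c]⟩
  · exact ⟨.C4, by simp [a, b, c], by rintro (_ | _) <;> simp [a, b, c]⟩
  · exact ⟨.C3, by simp [a, c], by rintro (_ | _) <;> simp [a, b, c]⟩
  · exact ⟨.C1, by simp [a, b], by rintro (_ | _) <;> simp [a, b, c]⟩

end NodeSystem

/-! ### Standard nodes realise the same admissible pairs. -/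

theorem standardNode_ab_hasFullRowRank (c : Cond) : HasFullRowRank (standardNode c).AB := by
  rw [NodeSystem.ab_hasFullRowRank_iff]
  cases c <;> decide

instance (S : NodeSystem) (a : Prop) [Decidable a] (w : Sym) : Decidable (S.Admits a w) := by
  unfold NodeSystem.Admits NodeSystem.out
  infer_instance

theorem standardNode_satisfies (c : Cond) : (standardNode c).Satisfies c := by
  cases c <;> simp only [NodeSystem.satisfies_iff] <;> decide

/-- A node system and its standard node system have the same admissible input-output pairs. -/
theorem IsStandardFor.admits_iff {T S : NodeSystem} (h : IsStandardFor T S)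
    (hS : HasFullRowRank S.AB) (a : Prop) (w : Sym) : T.Admits a w ↔ S.Admits a w := by
  obtain ⟨c, hc, rfl⟩ := h
  have h₁ := S.admits_of_hasFullRowRank hS
  have h₂ : S.Admits True 0 → S.Admits False .star → S.Admits True .star := NodeSystem.Admits.union
  have h₃ := (standardNode c).admits_of_hasFullRowRank (standardNode_ab_hasFullRowRank c)
  have h₄ : (standardNode c).Admits True 0 → (standardNode c).Admits False .star →
    (standardNode c).Admits True .star := NodeSystem.Admits.union
  have hc' := standardNode_satisfies c
  rw [NodeSystem.satisfies_iff] at hc hc'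
  -- Together with the two constraints valid for every such node, the condition `c` determines all
  -- three truth values.
  have key : ((standardNode c).Admits True 0 ↔ S.Admits True 0) ∧
      ((standardNode c).Admits True .star ↔ S.Admits True .star) ∧
      ((standardNode c).Admits False .star ↔ S.Admits False .star) := by
    generalize (standardNode c).Admits True 0 = A₁ at *
    generalize (standardNode c).Admits True .star = A₂ at *
    generalize (standardNode c).Admits False .star = A₃ at *
    cases c <;> simp only at hc hc' <;> tauto
  have hF : (standardNode c).Admits False 0 ↔ S.Admits False 0 :=
    iff_of_true (NodeSystem.admits_false_zero _) (NodeSystem.admits_false_zero _)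
  have hw : ∀ b : Prop, b = True ∨ b = False →
      ((standardNode c).Admits b 0 ↔ S.Admits b 0) ∧
      ((standardNode c).Admits b .star ↔ S.Admits b .star) := by
    rintro b (rfl | rfl)
    exacts [⟨key.1, key.2.1⟩, ⟨hF, key.2.2⟩]
  have := hw a (Classical.propComplete a)
  cases w
  · exact this.1
  · exact this.2
  · rw [NodeSystem.admits_any_iff, NodeSystem.admits_any_iff, this.1, this.2]

/-! ### The rank test of a network in terms of admissible pairs. -/

section Network

variable {N m : ℕ} (S : Fin N → NodeSystem)

theorem NodeSystem.mul_C (S : NodeSystem) (w : Sym) (j : Fin S.n) : w * S.C j = S.out w j := by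
  rcases eq_or_ne j S.outPos with rfl | hj
  · rw [C_eq_out, out_self, out_self, Sym.mul_star]
  · rw [C_eq_out, out_of_ne _ hj, out_of_ne _ hj, mul_zero]

theorem NodeSystem.sum_B_mul (S : NodeSystem) (I : Finset (Fin S.n)) (w : Sym) :
    ∑ i ∈ I, S.B i * w = if S.inPos ∈ I then w else 0 := by
  rw [← Finset.sum_mul]
  have : ∑ i ∈ I, S.B i = if S.inPos ∈ I then Sym.star else 0 :=
    Finset.sum_pi_single' S.inPos Sym.star I
  rw [this, ite_mul, Sym.star_mul, zero_mul]

theorem blkB_mul_apply {κ : Type*} (M : Matrix (Fin N) κ Sym) (i : StateIdx S) (j : κ) :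
    (blkB S * M) i j = (S i.1).B i.2 * M i.1 j := by
  simp [mul_apply, blkB]

theorem mul_blkC_apply {κ : Type*} (M : Matrix κ (Fin N) Sym) (i : κ) (j : StateIdx S) :
    (M * blkC S) i j = M i j.1 * (S j.1).C j.2 := by
  simp [mul_apply, blkC]

variable (W : Matrix (Fin N) (Fin N) Sym) (H : Matrix (Fin N) (Fin m) Sym)

/-- The rows are chosen blockwise. Block `l` feeds `𝒲` into the sum only through its input row, and
column block `k` receives it only at its output position. -/
theorem sum_networkPattern_inl (t : ∀ k, Finset (Fin (S k).n)) (k : Fin N) (j : Fin (S k).n) :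
    ∑ i ∈ Finset.univ.sigma t, networkPattern S W H i (.inl ⟨k, j⟩) =
      ∑ i ∈ t k, (S k).A i j + (S k).out (∑ l with (S l).inPos ∈ t l, W l k) j := by
  have hA : ∑ i ∈ Finset.univ.sigma t, blkA S i ⟨k, j⟩ = ∑ i ∈ t k, (S k).A i j := by
    rw [Finset.sum_sigma, Finset.sum_eq_single k]
    · simp [blkA, blockDiagonal'_apply]
    · intro l _ hl
      simp [blkA, blockDiagonal'_apply, hl]
    · simp
  have hW : ∑ i ∈ Finset.univ.sigma t, (blkB S * W * blkC S) i ⟨k, j⟩ =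
      (S k).out (∑ l with (S l).inPos ∈ t l, W l k) j := by
    simp only [mul_blkC_apply, blkB_mul_apply]
    rw [← Finset.sum_mul, NodeSystem.mul_C, Finset.sum_sigma, Finset.sum_filter]
    simp only [NodeSystem.sum_B_mul]
  rw [← hA, ← hW, ← Finset.sum_add_distrib]
  rfl

theorem sum_networkPattern_inr (t : ∀ k, Finset (Fin (S k).n)) (c : Fin m) :
    ∑ i ∈ Finset.univ.sigma t, networkPattern S W H i (.inr c) =
      ∑ l with (S l).inPos ∈ t l, H l c := by
  change ∑ i ∈ Finset.univ.sigma t, (blkB S * H) i c = _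
  simp only [blkB_mul_apply]
  rw [Finset.sum_sigma, Finset.sum_filter]
  simp only [NodeSystem.sum_B_mul]

/-- Whether the network pattern matrix has full row rank depends on the node systems only
through the pairs that they admit. -/
theorem networkPattern_hasFullRowRank_iff (hS : ∀ k, HasFullRowRank (S k).AB) :
    HasFullRowRank (networkPattern S W H) ↔
      ¬ ∃ J : Finset (Fin N), J.Nonempty ∧ (∀ k, (S k).Admits (k ∈ J) (∑ l ∈ J, W l k)) ∧
        ∀ c, ∑ l ∈ J, H l c ≠ .star := by
  rw [hasFullRowRank_iff, iff_not_comm]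
  push Not
  constructor
  · rintro ⟨J, hJ, hA, hH⟩
    choose t ht h using hA
    have hJt : (Finset.univ.filter fun l => (S l).inPos ∈ t l) = J := by
      ext l; simp [ht]
    obtain ⟨k, hk⟩ := hJ
    refine ⟨Finset.univ.sigma t, ⟨⟨k, (S k).inPos⟩, by simpa [ht] using hk⟩, ?_⟩
    rintro (⟨l, j⟩ | c)
    · rw [sum_networkPattern_inl, hJt]
      exact h l j
    · rw [sum_networkPattern_inr, hJt]
      exact hH c
  · rintro ⟨I, ⟨⟨k, i⟩, hI⟩, h⟩
    classical
    let t (k : Fin N) : Finset (Fin (S k).n) := Finset.univ.filter fun i => ⟨k, i⟩ ∈ I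
    have ht : Finset.univ.sigma t = I := by ext ⟨l, j⟩; simp [t]
    rw [← ht] at h
    have hA (k : Fin N) (j : Fin (S k).n) := sum_networkPattern_inl S W H t k j ▸ h (.inl ⟨k, j⟩)
    refine ⟨Finset.univ.filter fun l => (S l).inPos ∈ t l, ?_,
      fun k => ⟨t k, by simp, hA k⟩, fun c => sum_networkPattern_inr S W H t c ▸ h (.inr c)⟩
    -- Without any input row the interconnection contributes nothing, so a nonempty `t k` would
    -- violate the full row rank of `[𝒜ₖ ℬₖ]`.
    by_contra hne
    rw [Finset.not_nonempty_iff_eq_empty] at hne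
    have hk : (S k).inPos ∉ t k := fun hk => by
      simpa [hk] using congrArg (k ∈ ·) hne
    obtain ⟨j, hj⟩ := (S k).ab_hasFullRowRank_iff.1 (hS k) (t k) ⟨i, by simpa [t] using hI⟩ hk
    refine hA k j ?_
    rw [hne, hj, Finset.sum_empty, NodeSystem.out_zero, add_zero]

theorem IsStandardFor.ab_hasFullRowRank {T S : NodeSystem} (h : IsStandardFor T S) :
    HasFullRowRank T.AB := by
  obtain ⟨c, -, rfl⟩ := h
  exact standardNode_ab_hasFullRowRank c

theorem IsStandardFor.n_eq {T S : NodeSystem} (h : IsStandardFor T S) : T.n = 1 ∨ T.n = 2 := by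
  obtain ⟨c, -, rfl⟩ := h
  cases c <;> simp [standardNode]

variable {S}

theorem networkPattern_hasFullRowRank_iff_of_isStandardFor {R : Fin N → NodeSystem}
    (hS : ∀ k, HasFullRowRank (S k).AB) (hR : ∀ k, IsStandardFor (R k) (S k)) :
    HasFullRowRank (networkPattern R W H) ↔ HasFullRowRank (networkPattern S W H) := by
  rw [networkPattern_hasFullRowRank_iff R W H fun k => (hR k).ab_hasFullRowRank,
    networkPattern_hasFullRowRank_iff S W H hS]
  simp only [fun k => (hR k).admits_iff (hS k)]

theorem card_stateIdx_le {R : Fin N → NodeSystem} (hR : ∀ k, IsStandardFor (R k) (S k)) :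
    Fintype.card (StateIdx R) ≤ 2 * N := by
  rw [Fintype.card_sigma]
  calc ∑ k, Fintype.card (Fin (R k).n) ≤ ∑ _k : Fin N, 2 :=
        Finset.sum_le_sum fun k _ => by
          rw [Fintype.card_fin]; have := (hR k).n_eq; omega
    _ = 2 * N := by simp [mul_comm]

end Network

/-! ### Controllability, invariant subspaces and the two rank conditions. -/

section Controllability

variable {ι μ : Type*} [Fintype ι] [Fintype μ]

section Exponential

variable [DecidableEq ι]

attribute [local instance] Matrix.linftyOpNormedRing Matrix.linftyOpNormedAlgebra

/-- The matrix exponential. Derivatives are stated entrywise, so the matrix norm is needed only in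
this section. -/
theorem exists_fundamentalMatrix (A : Matrix ι ι ℝ) :
    ∃ Φ : ℝ → Matrix ι ι ℝ, Φ 0 = 1 ∧ (∀ t, Φ t * Φ (-t) = 1) ∧
      ∀ t i j, HasDerivAt (fun s => Φ s i j) ((A * Φ t) i j) t := by
  refine ⟨fun t => NormedSpace.exp (t • A), by simp, fun t => ?_, fun t i j => ?_⟩
  · dsimp only
    rw [neg_smul, ← Matrix.exp_add_of_commute (t • A) (-(t • A)) (Commute.neg_right (Commute.refl _)),
      add_neg_cancel, NormedSpace.exp_zero]
  · exact (LinearMap.toContinuousLinearMap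
      (Matrix.entryLinearMap ℝ ℝ i j)).hasFDerivAt.comp_hasDerivAt t
      (hasDerivAt_exp_smul_const' (𝕂 := ℝ) A t)

end Exponential

/-- A controllable system has no left eigenvector in the left kernel of the input matrix. -/
theorem IsControllable.eq_zero_of_vecMul_eq_smul {A : Matrix ι ι ℝ} {B : Matrix ι μ ℝ}
    (h : IsControllable A B) {z : ι → ℝ} {c : ℝ} (hA : z ᵥ* A = c • z) (hB : z ᵥ* B = 0) :
    z = 0 := by
  -- Steer from `0` to `z` itself: `exp (-c t) (z ⬝ x t)` is constant along the trajectory, which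
  -- forces `z ⬝ z = 0`.
  obtain ⟨T, hT, u, x, -, hx0, hxT, hx⟩ := h 0 z
  have hd (t : ℝ) (ht : t ∈ Set.Icc 0 T) :
      HasDerivWithinAt (fun s => Real.exp (-c * s) * (z ⬝ᵥ x s)) 0 (Set.Icc 0 T) t := by
    have h1 : HasDerivWithinAt (fun s => z ⬝ᵥ x s) (c * (z ⬝ᵥ x t)) (Set.Icc 0 T) t := by
      have h2 : HasDerivWithinAt (fun s => z ⬝ᵥ x s) (z ⬝ᵥ (A *ᵥ x t + B *ᵥ u t))
          (Set.Icc 0 T) t :=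
        HasDerivWithinAt.fun_sum fun i _ => ((hasDerivWithinAt_pi.1 (hx t ht)) i).const_mul (z i)
      rwa [dotProduct_add, dotProduct_mulVec, dotProduct_mulVec, hA, hB, zero_dotProduct,
        add_zero, smul_dotProduct, smul_eq_mul] at h2
    have h3 : HasDerivWithinAt (fun s => Real.exp (-c * s)) (Real.exp (-c * t) * (-c * 1))
        (Set.Icc 0 T) t := (((hasDerivAt_id t).const_mul (-c)).exp).hasDerivWithinAt
    exact (h3.mul h1).congr_deriv (by ring)
  have hconst := constant_of_derivWithin_zero (fun t ht => (hd t ht).differentiableWithinAt)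
    (fun t ht => (hd t (Set.Ico_subset_Icc_self ht)).derivWithin
      (uniqueDiffOn_Icc hT t (Set.Ico_subset_Icc_self ht))) T (Set.right_mem_Icc.2 hT.le)
  rw [hx0, hxT, dotProduct_zero, mul_zero] at hconst
  exact dotProduct_self_eq_zero.1 ((mul_eq_zero.1 hconst).resolve_left (Real.exp_ne_zero _))

theorem hasDerivAt_vecMul_of_hasDerivAt {μ : Type*} {A : Matrix ι ι ℝ} {F : ℝ → Matrix ι μ ℝ}
    (hF : ∀ s i c, HasDerivAt (fun s => F s i c) (-(A * F s) i c) s) (z : ι → ℝ) (c : μ) (s : ℝ) :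
    HasDerivAt (fun s => (z ᵥ* F s) c) (-((z ᵥ* A) ᵥ* F s) c) s := by
  have := HasDerivAt.fun_sum (u := Finset.univ) fun i _ => (hF s i c).const_mul (z i)
  refine this.congr_deriv ?_
  rw [vecMul_vecMul]
  simp [vecMul, dotProduct]

/-- The vectors that annihilate `exp (-s A) B` on an interval form an invariant subspace. -/
theorem eq_zero_of_forall_vecMul_eq_zero {μ : Type*} {A : Matrix ι ι ℝ} {B : Matrix ι μ ℝ}
    (h : ∀ V : Submodule ℝ (ι → ℝ), (∀ z ∈ V, z ᵥ* A ∈ V) → (∀ z ∈ V, z ᵥ* B = 0) → V = ⊥)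
    {F : ℝ → Matrix ι μ ℝ} (hF0 : F 0 = B)
    (hF : ∀ s i c, HasDerivAt (fun s => F s i c) (-(A * F s) i c) s) {z : ι → ℝ}
    (hz : ∀ s ∈ Set.Icc (0 : ℝ) 1, z ᵥ* F s = 0) : z = 0 := by
  let V : Submodule ℝ (ι → ℝ) :=
    { carrier := {z | ∀ s ∈ Set.Icc (0 : ℝ) 1, z ᵥ* F s = 0}
      add_mem' := fun ha hb s hs => by rw [add_vecMul, ha s hs, hb s hs, add_zero]
      zero_mem' := fun s _ => zero_vecMul _
      smul_mem' := fun c a ha s hs => by rw [smul_vecMul, ha s hs, smul_zero] }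
  have hbot : V = ⊥ := by
    refine h V (fun z (hz : ∀ s ∈ Set.Icc (0 : ℝ) 1, z ᵥ* F s = 0) s hs => funext fun c => ?_)
      fun z (hz : ∀ s ∈ Set.Icc (0 : ℝ) 1, z ᵥ* F s = 0) => ?_
    -- Differentiating `z F(s) = 0` gives `z A F(s) = 0`; derivatives within the interval also cover
    -- its endpoints.
    · have h1 := (hasDerivAt_vecMul_of_hasDerivAt hF z c s).hasDerivWithinAt (s := Set.Icc 0 1)
      have h2 : HasDerivWithinAt (fun s => (z ᵥ* F s) c) 0 (Set.Icc 0 1) s :=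
        (hasDerivWithinAt_const s _ (0 : ℝ)).congr
          (fun t ht => by rw [hz t ht, Pi.zero_apply]) (by rw [hz s hs, Pi.zero_apply])
      have hu : UniqueDiffWithinAt ℝ (Set.Icc (0 : ℝ) 1) s := uniqueDiffOn_Icc zero_lt_one s hs
      exact neg_eq_zero.1 (hu.eq_deriv _ h1 h2)
    · rw [← hF0]
      exact hz 0 (Set.left_mem_Icc.2 zero_le_one)
  have : z ∈ V := hz
  rwa [hbot, Submodule.mem_bot] at this

theorem hasDerivAt_mul_of_hasDerivAt {μ : Type*} {A : Matrix ι ι ℝ} {Φ : ℝ → Matrix ι ι ℝ}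
    (hΦ : ∀ t i j, HasDerivAt (fun s => Φ s i j) ((A * Φ t) i j) t) (B : Matrix ι μ ℝ) (s : ℝ)
    (i : ι) (c : μ) :
    HasDerivAt (fun s => (Φ (-s) * B) i c) (-(A * (Φ (-s) * B)) i c) s := by
  have h1 (j : ι) : HasDerivAt (fun s => Φ (-s) i j * B j c) (-(A * Φ (-s)) i j * B j c) s := by
    have h0 := (hΦ (-s) i j).scomp s (hasDerivAt_neg s)
    exact (h0.congr_deriv (by simp)).mul_const (B j c)
  have h2 := HasDerivAt.fun_sum (u := Finset.univ) fun j _ => h1 j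
  have h3 : (fun s => (Φ (-s) * B) i c) = fun s => ∑ j, Φ (-s) i j * B j c :=
    funext fun s => mul_apply
  rw [h3]
  refine h2.congr_deriv ?_
  rw [← Matrix.mul_assoc, mul_apply]
  simp [Finset.sum_neg_distrib]

/-- If the left kernel of `B` contains no nonzero subspace that is invariant under `z ↦ zᵀ A`,
then the system is controllable. -/
theorem isControllable_of_forall_invariant_eq_bot {A : Matrix ι ι ℝ} {B : Matrix ι μ ℝ}
    (h : ∀ V : Submodule ℝ (ι → ℝ), (∀ z ∈ V, z ᵥ* A ∈ V) → (∀ z ∈ V, z ᵥ* B = 0) → V = ⊥) :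
    IsControllable A B := by
  classical
  obtain ⟨Φ, hΦ0, hΦinv, hΦ⟩ := exists_fundamentalMatrix A
  obtain ⟨F, hFΦ⟩ : ∃ F : ℝ → Matrix ι μ ℝ, ∀ s, F s = Φ (-s) * B := ⟨_, fun _ => rfl⟩
  have hF (s : ℝ) (i : ι) (c : μ) : HasDerivAt (fun s => F s i c) (-(A * F s) i c) s := by
    simp only [hFΦ]
    exact hasDerivAt_mul_of_hasDerivAt hΦ B s i c
  have hFc (i : ι) (c : μ) : Continuous fun s => F s i c :=
    continuous_iff_continuousAt.2 fun s => (hF s i c).continuousAt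
  have hzF (z : ι → ℝ) (c : μ) : Continuous fun s => (z ᵥ* F s) c :=
    continuous_finsetSum _ fun i _ => continuous_const.mul (hFc i c)
  have hV (z : ι → ℝ) (hz : ∀ s ∈ Set.Icc (0 : ℝ) 1, z ᵥ* F s = 0) : z = 0 :=
    eq_zero_of_forall_vecMul_eq_zero h (by rw [hFΦ, neg_zero, hΦ0, Matrix.one_mul]) hF hz
  -- The controllability Gramian on `[0, 1]`.
  obtain ⟨G, hGF⟩ : ∃ G : Matrix ι ι ℝ,
      ∀ i j, G i j = ∫ s in (0 : ℝ)..1, ∑ c, F s i c * F s j c := ⟨of _, fun _ _ => rfl⟩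
  have hG (z : ι → ℝ) (i : ι) : (G *ᵥ z) i = ∫ s in (0 : ℝ)..1, (F s *ᵥ (z ᵥ* F s)) i := by
    have : ∀ j, G i j * z j = ∫ s in (0 : ℝ)..1, (∑ c, F s i c * F s j c) * z j :=
      fun j => by rw [hGF, intervalIntegral.integral_mul_const]
    simp only [mulVec, dotProduct, this]
    rw [← intervalIntegral.integral_finsetSum]
    · congr 1
      ext s
      simp only [vecMul, dotProduct, Finset.sum_mul, Finset.mul_sum]
      rw [Finset.sum_comm]
      exact Finset.sum_congr rfl fun c _ => Finset.sum_congr rfl fun j _ => by ring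
    · exact fun j _ => ((continuous_finsetSum _ fun c _ =>
        (hFc i c).mul (hFc j c)).mul continuous_const).intervalIntegrable _ _
  have hFu (z : ι → ℝ) (i : ι) : Continuous fun s => (F s *ᵥ (z ᵥ* F s)) i :=
    continuous_finsetSum _ fun c _ => (hFc i c).mul (hzF z c)
  -- `z ⬝ G z` is the integral of `|z F(s)|²`, so it vanishes only if `z F = 0` on `[0, 1]`, and
  -- then `z = 0`.
  have hGinj : Function.Injective G.mulVec := by
    refine (injective_iff_map_eq_zero G.mulVecLin).2 fun z hz => hV z fun s hs => ?_
    by_contra hne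
    obtain ⟨c, hc⟩ := Function.ne_iff.1 hne
    have hpos : 0 < ∫ s in (0 : ℝ)..1, ∑ c, (z ᵥ* F s) c * (z ᵥ* F s) c :=
      intervalIntegral.integral_pos one_pos
        (continuous_finsetSum _ fun c _ => (hzF z c).mul (hzF z c)).continuousOn
        (fun s _ => Finset.sum_nonneg fun c _ => mul_self_nonneg _)
        ⟨s, hs, Finset.sum_pos' (fun c _ => mul_self_nonneg _)
          ⟨c, Finset.mem_univ c, mul_self_pos.2 hc⟩⟩
    have hzero : z ⬝ᵥ (G *ᵥ z) = ∫ s in (0 : ℝ)..1, ∑ c, (z ᵥ* F s) c * (z ᵥ* F s) c := by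
      simp only [dotProduct, hG]
      simp only [← intervalIntegral.integral_const_mul]
      rw [← intervalIntegral.integral_finsetSum]
      · congr 1
        ext s
        exact dotProduct_mulVec z (F s) (z ᵥ* F s)
      · exact fun i _ => (continuous_const.mul (hFu z i)).intervalIntegrable _ _
    rw [← hzero, show G *ᵥ z = 0 from hz, dotProduct_zero] at hpos
    exact hpos.false
  have hGsurj : Function.Surjective G.mulVec :=
    (LinearMap.injective_iff_surjective (f := G.mulVecLin)).1 hGinj
  intro x₀ x₁
  obtain ⟨z, hz⟩ := hGsurj (Φ (-1) *ᵥ x₁ - x₀)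
  -- Variation of constants with input `z F(t)`: the state is `Φ t v(t)`, and `v 1 = x₀ + G z = Φ
  -- (-1) x₁`.
  let v (t : ℝ) : ι → ℝ := fun i => x₀ i + ∫ s in (0 : ℝ)..t, (F s *ᵥ (z ᵥ* F s)) i
  refine ⟨1, one_pos, fun t => z ᵥ* F t, fun t => Φ t *ᵥ v t,
    (continuous_pi fun c => hzF z c).continuousOn, ?_, ?_, fun t _ => ?_⟩
  · simp [v, hΦ0]
  · have : v 1 = Φ (-1) *ᵥ x₁ := by
      ext i
      have := congrFun hz i
      rw [hG, Pi.sub_apply] at this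
      simp only [v, this]
      ring
    simp only [this, mulVec_mulVec, hΦinv, one_mulVec]
  · refine HasDerivAt.hasDerivWithinAt (hasDerivAt_pi.2 fun i => ?_)
    have hv (j : ι) : HasDerivAt (fun t => v t j) ((F t *ᵥ (z ᵥ* F t)) j) t :=
      ((hFu z j).integral_hasStrictDerivAt 0 t).hasDerivAt.const_add (x₀ j)
    have := HasDerivAt.fun_sum (u := Finset.univ) fun j _ => (hΦ t i j).mul (hv j)
    refine this.congr_deriv ?_
    rw [Finset.sum_add_distrib]
    change ((A * Φ t) *ᵥ v t) i + (Φ t *ᵥ (F t *ᵥ (z ᵥ* F t))) i = _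
    rw [← mulVec_mulVec, mulVec_mulVec _ (Φ t) (F t)]
    rw [show Φ t * F t = B by rw [hFΦ, ← Matrix.mul_assoc, hΦinv, Matrix.one_mul]]
    rfl

/-- A nonzero invariant subspace in the left kernel of `B` yields a left kernel vector of
`[A B]` or of `[A + D B]` for some nonsingular diagonal matrix `D`. -/
theorem exists_vecMul_eq_zero_of_invariant {μ : Type*} [DecidableEq ι] {A : Matrix ι ι ℝ} {B : Matrix ι μ ℝ}
    {V : Submodule ℝ (ι → ℝ)} (hA : ∀ z ∈ V, z ᵥ* A ∈ V) (hB : ∀ z ∈ V, z ᵥ* B = 0)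
    (hV : V ≠ ⊥) :
    ∃ z ≠ 0, z ᵥ* B = 0 ∧
      (z ᵥ* A = 0 ∨ ∃ d : ι → ℝ, (∀ i, d i ≠ 0) ∧ z ᵥ* (A + diagonal d) = 0) := by
  let f : V →ₗ[ℝ] V := A.vecMulLinear.restrict hA
  by_cases hf : Function.Injective f
  · have hsurj := LinearMap.injective_iff_surjective.1 hf
    -- The coordinates that do not vanish identically on `V`.
    let α := {i : ι // ∃ z ∈ V, z i ≠ 0}
    let g : α ⊕ α → Module.Dual ℝ (ι → ℝ) :=
      Sum.elim (fun i => LinearMap.proj i.1) fun i => LinearMap.proj i.1 ∘ₗ A.vecMulLinear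
    -- Finitely many functionals, none zero on `V`, are nonzero at a common point. The functionals
    -- `z ↦ (z A) i` qualify because `A` maps `V` onto `V`.
    obtain ⟨w, hw, hg⟩ := Module.Dual.exists_forall_mem_ne_zero_of_forall_exists V g (by
      rintro (⟨i, z, hz, hi⟩ | ⟨i, z, hz, hi⟩)
      · exact ⟨z, hz, hi⟩
      · obtain ⟨y, hy⟩ := hsurj ⟨z, hz⟩
        have hy' : y.1 ᵥ* A = z := congrArg Subtype.val hy
        exact ⟨y, y.2, by simpa [g, hy'] using hi⟩)
    have hw0 (i : ι) (z : ι → ℝ) (hz : z ∈ V) (hi : z i ≠ 0) : w i ≠ 0 ∧ (w ᵥ* A) i ≠ 0 :=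
      ⟨hg (.inl ⟨i, z, hz, hi⟩), hg (.inr ⟨i, z, hz, hi⟩)⟩
    obtain ⟨z, hz, hz0⟩ := V.exists_mem_ne_zero_of_ne_bot hV
    obtain ⟨i, hi⟩ := Function.ne_iff.1 hz0
    -- Where `w i = 0`, also `(w A) i = 0`, and any nonzero diagonal entry serves; `1` is chosen.
    refine ⟨w, fun h => (hw0 i z hz hi).1 (by rw [h]; rfl), hB w hw, .inr
      ⟨fun i => if w i = 0 then 1 else -(w ᵥ* A) i / w i, fun i => ?_, ?_⟩⟩
    · dsimp only
      split_ifs with h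
      · exact one_ne_zero
      · exact div_ne_zero (neg_ne_zero.2 (hw0 i w hw h).2) h
    · ext i
      rw [vecMul_add, Pi.add_apply, vecMul_diagonal, Pi.zero_apply]
      split_ifs with h
      · have : (w ᵥ* A) i = 0 := by
          by_contra hne
          exact (hw0 i _ (hA w hw) hne).1 h
        rw [this, h]; ring
      · field_simp
        ring
  · rw [injective_iff_map_eq_zero] at hf
    push Not at hf
    obtain ⟨z, hz, hz0⟩ := hf
    exact ⟨z, fun h => hz0 (Subtype.ext h), hB z z.2, .inl (congrArg Subtype.val hz)⟩

/-- Every system with pattern matrices `𝒳`, `𝒴` is controllable if and only if `[𝒳 𝒴]` and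
`[𝒳 + D 𝒴]` have full row rank, where `D` is the diagonal pattern matrix with diagonal `∗`. -/
theorem forall_isControllable_iff [DecidableEq ι] (P : Matrix ι ι Sym) (Q : Matrix ι μ Sym) :
    (∀ X ∈ patternClass P, ∀ Y ∈ patternClass Q, IsControllable X Y) ↔
      HasFullRowRank (fromCols P Q) ∧
        HasFullRowRank (fromCols (P + diagonal fun _ => Sym.star) Q) := by
  have hdiag (d : ι → ℝ) :
      diagonal d ∈ patternClass (diagonal fun _ : ι => Sym.star) ↔ ∀ i, d i ≠ 0 := by
    refine ⟨fun h i => by simpa [Sym.Allows] using h i i, fun h i j => ?_⟩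
    rcases eq_or_ne i j with rfl | hij
    · simpa [Sym.Allows] using h i
    · simp [hij]
  constructor
  · intro h
    refine ⟨fun M hM => linearIndependent_row_iff.2 fun z hz => ?_,
      fun M hM => linearIndependent_row_iff.2 fun z hz => ?_⟩
    all_goals
      have hY : M.toCols₂ ∈ patternClass Q := fun i c => hM i (.inr c)
      have hzY : z ᵥ* M.toCols₂ = 0 := funext fun c => congrFun hz (.inr c)
      have hzX : z ᵥ* M.toCols₁ = 0 := funext fun c => congrFun hz (.inl c)
    · have hX : M.toCols₁ ∈ patternClass P := fun i j => hM i (.inl j)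
      exact (h _ hX _ hY).eq_zero_of_vecMul_eq_smul (c := 0) (by rw [hzX, zero_smul]) hzY
    · have hX : M.toCols₁ ∈ patternClass (P + diagonal fun _ => Sym.star) :=
        fun i j => hM i (.inl j)
      obtain ⟨X, hX, D, hD, hXD⟩ := exists_add_of_mem_patternClass hX
      have hD' : D = diagonal fun i => D i i := by
        ext i j
        rcases eq_or_ne i j with rfl | hij
        · simp
        · simpa [hij] using hD i j
      have hd : ∀ i, D i i ≠ 0 := (hdiag _).1 (hD' ▸ hD)
      -- Scaling columns by nonzero factors preserves the pattern class, and `z (X + D) = 0` becomes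
      -- `z X D⁻¹ = -z`.
      refine (h (X * diagonal fun i => (D i i)⁻¹) (fun i j => ?_) _ hY).eq_zero_of_vecMul_eq_smul
        (c := -1) ?_ hzY
      · rw [mul_diagonal, mul_comm]
        exact (Sym.allows_mul_iff (inv_ne_zero (hd j))).2 (hX i j)
      · rw [← hXD, vecMul_add, hD'] at hzX
        rw [← vecMul_vecMul, eq_neg_of_add_eq_zero_left hzX]
        ext i
        simp [vecMul_diagonal, hd i]
  · rintro ⟨h₁, h₂⟩ X hX Y hY
    refine isControllable_of_forall_invariant_eq_bot fun V hA hB => ?_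
    by_contra hV
    obtain ⟨z, hz, hzY, h | ⟨d, hd, h⟩⟩ := exists_vecMul_eq_zero_of_invariant hA hB hV
    · refine hz (linearIndependent_row_iff.1 (h₁ _ (fromCols_mem_patternClass hX hY)) z ?_)
      rw [vecMul_fromCols, h, hzY]
      ext (_ | _) <;> rfl
    · refine hz (linearIndependent_row_iff.1 (h₂ _ (fromCols_mem_patternClass
        (add_mem_patternClass hX ((hdiag d).2 hd)) hY)) z ?_)
      rw [vecMul_fromCols, h, hzY]
      ext (_ | _) <;> rfl

end Controllability

/-! ### The network as a pair of pattern matrices, and its barred version. -/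

section Network

variable {N m : ℕ} (S : Fin N → NodeSystem)

/-- Barring a diagonal symbol is adding `∗` to it, so the second rank condition is the rank test of
the barred network. -/
theorem blkA_add_diagonal :
    (blkA S + diagonal fun _ => Sym.star : Matrix (StateIdx S) (StateIdx S) Sym) =
      blkA fun k => (S k).bar := by
  ext ⟨k, i⟩ ⟨l, j⟩
  rcases eq_or_ne k l with rfl | hkl
  · rcases eq_or_ne i j with rfl | hij
    · simp [blkA, blockDiagonal'_apply, NodeSystem.bar, barMatrix, Sym.bar_eq_add_star]
    · simp [blkA, blockDiagonal'_apply, NodeSystem.bar, barMatrix, hij]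
  · have hne : (⟨k, i⟩ : StateIdx S) ≠ ⟨l, j⟩ := fun h => hkl (congrArg Sigma.fst h)
    rw [Matrix.add_apply, diagonal_apply_ne _ hne, add_zero, blkA, blockDiagonal'_apply_ne _ _ _ hkl]
    exact (blockDiagonal'_apply_ne (fun k => (S k).bar.A) i j hkl).symm

theorem fromCols_add_diagonal_hasFullRowRank_iff (W : Matrix (Fin N) (Fin N) Sym)
    (H : Matrix (Fin N) (Fin m) Sym) :
    HasFullRowRank (fromCols (blkA S + blkB S * W * blkC S +
        (diagonal fun _ => Sym.star : Matrix (StateIdx S) (StateIdx S) Sym)) (blkB S * H)) ↔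
      HasFullRowRank (networkPattern (fun k => (S k).bar) W H) := by
  rw [add_right_comm, blkA_add_diagonal]
  rfl

/-- The systems of a structured network are those with pattern matrices `𝒜 + ℬ𝒲𝒞` and `ℬℋ`. -/
theorem isStronglyStructurallyControllable_iff (W : Matrix (Fin N) (Fin N) Sym)
    (H : Matrix (Fin N) (Fin m) Sym) :
    IsStronglyStructurallyControllable S W H ↔
      ∀ X ∈ patternClass (blkA S + blkB S * W * blkC S), ∀ Y ∈ patternClass (blkB S * H),
        IsControllable X Y := by
  constructor
  · intro h X hX Y hY
    obtain ⟨A, hA, Z, hZ, rfl⟩ := exists_add_of_mem_patternClass hX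
    -- With 0-1 matrices `B` and `C`, the products only place the entries of `W'` and `H'` at input
    -- and output positions. These entries can therefore be read off from `Z` and `Y`, which vanish
    -- elsewhere.
    let B : Matrix (StateIdx S) (Fin N) ℝ :=
      of fun i l => if i.1 = l then (Pi.single (S i.1).inPos 1 : _ → ℝ) i.2 else 0
    let C : Matrix (Fin N) (StateIdx S) ℝ :=
      of fun l i => if i.1 = l then (Pi.single (S i.1).outPos 1 : _ → ℝ) i.2 else 0
    have hsingle {n : ℕ} (p i : Fin n) :
        ((Pi.single p Sym.star : Fin n → Sym) i).Allows ((Pi.single p 1 : Fin n → ℝ) i) := by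
      rcases eq_or_ne i p with rfl | hi
      · simp [Sym.Allows]
      · simp [hi]
    have hB : B ∈ patternClass (blkB S) := fun i l => by
      simp only [B, blkB, of_apply]
      split_ifs
      exacts [hsingle _ _, rfl]
    have hC : C ∈ patternClass (blkC S) := fun l i => by
      simp only [C, blkC, of_apply]
      split_ifs
      exacts [hsingle _ _, rfl]
    let W' : Matrix (Fin N) (Fin N) ℝ := of fun k l => Z ⟨k, (S k).inPos⟩ ⟨l, (S l).outPos⟩
    let H' : Matrix (Fin N) (Fin m) ℝ := of fun k c => Y ⟨k, (S k).inPos⟩ c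
    have hW' : W' ∈ patternClass W := fun k l => by
      have := hZ ⟨k, (S k).inPos⟩ ⟨l, (S l).outPos⟩
      change (W k l).Allows (Z ⟨k, (S k).inPos⟩ ⟨l, (S l).outPos⟩)
      simpa [mul_blkC_apply, blkB_mul_apply, NodeSystem.B, NodeSystem.C, Sym.star_mul,
        Sym.mul_star] using this
    have hH' : H' ∈ patternClass H := fun k c => by
      have := hY ⟨k, (S k).inPos⟩ c
      change (H k c).Allows (Y ⟨k, (S k).inPos⟩ c)
      simpa [blkB_mul_apply, NodeSystem.B, Sym.star_mul] using this
    have hZ' : B * W' * C = Z := by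
      ext ⟨k, i⟩ ⟨l, j⟩
      have := hZ ⟨k, i⟩ ⟨l, j⟩
      rw [mul_blkC_apply, blkB_mul_apply] at this
      by_cases hi : i = (S k).inPos
      · by_cases hj : j = (S l).outPos
        · subst hi hj
          simp [mul_apply, B, C, W']
        · have h0 : Z ⟨k, i⟩ ⟨l, j⟩ = 0 := by simpa [NodeSystem.C, hj] using this
          simp [mul_apply, C, hj, h0]
      · have h0 : Z ⟨k, i⟩ ⟨l, j⟩ = 0 := by simpa [NodeSystem.B, hi] using this
        simp [mul_apply, B, hi, h0]
    have hY' : B * H' = Y := by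
      ext ⟨k, i⟩ c
      have := hY ⟨k, i⟩ c
      rw [blkB_mul_apply] at this
      by_cases hi : i = (S k).inPos
      · subst hi
        simp [mul_apply, B, H']
      · have h0 : Y ⟨k, i⟩ c = 0 := by simpa [NodeSystem.B, hi] using this
        simp [mul_apply, B, hi, h0]
    rw [← hZ', ← hY']
    exact h A hA B hB C hC W' hW' H' hH'
  · intro h A hA B hB C hC W' hW' H' hH'
    exact h _ (add_mem_patternClass hA (mul_mem_patternClass (mul_mem_patternClass hB hW') hC)) _
      (mul_mem_patternClass hB hH')

end Network

end StructuredNetwork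

theorem mainTheorem1 (N m : ℕ) (S : Fin N → NodeSystem)
    (W : Matrix (Fin N) (Fin N) Sym) (H : Matrix (Fin N) (Fin m) Sym)
    (hS : ∀ k, HasFullRowRank (S k).AB) (hSbar : ∀ k, HasFullRowRank (S k).bar.AB) :
    -- each node system, and each barred node system, satisfies exactly one of the six conditions
    (∀ k, ∃! c, (S k).Satisfies c) ∧ (∀ k, ∃! c, (S k).bar.Satisfies c) ∧
    -- the reduction, with the standard node systems that correspond to them
    ∀ R Rbar : Fin N → NodeSystem,
      (∀ k, IsStandardFor (R k) (S k)) → (∀ k, IsStandardFor (Rbar k) (S k).bar) →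
        (IsStronglyStructurallyControllable S W H ↔
          HasFullRowRank (networkPattern R W H) ∧ HasFullRowRank (networkPattern Rbar W H)) ∧
        (∀ k, ((R k).n = 1 ∨ (R k).n = 2) ∧ ((Rbar k).n = 1 ∨ (Rbar k).n = 2)) ∧
        Fintype.card (StateIdx R) ≤ 2 * N ∧ Fintype.card (StateIdx Rbar) ≤ 2 * N := by
  refine ⟨fun k => (S k).existsUnique_satisfies (hS k),
    fun k => (S k).bar.existsUnique_satisfies (hSbar k), fun R Rbar hR hRbar =>
      ⟨?_, fun k => ⟨(hR k).n_eq, (hRbar k).n_eq⟩, card_stateIdx_le hR,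
        card_stateIdx_le (S := fun k => (S k).bar) hRbar⟩⟩
  rw [isStronglyStructurallyControllable_iff, forall_isControllable_iff,
    networkPattern_hasFullRowRank_iff_of_isStandardFor W H hS hR,
    networkPattern_hasFullRowRank_iff_of_isStandardFor W H (S := fun k => (S k).bar) hSbar hRbar]
  exact and_congr Iff.rfl (fromCols_add_diagonal_hasFullRowRank_iff S W H)
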